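/- Let $(X,\mathcal B,\mu)$ be a standard Borel space with a nonzero, atomless, $\sigma$-finite measure, and let $T$ be an action of a group $\mathbb G$ on $X$ by measurable, $\mu$-preserving transformations. For a measurable space $Y$ let $Y^*$ be the space of countable subsets of $Y$ with the $\sigma$-algebra generated by the events $\{|\omega\cap B|=n\}$ ($B$ measurable, $n\ge 0$); for a measure $\nu$ on $Y$ let $\nu^*$ be the law on $Y^*$ of the Poisson process of intensity $\nu$: the counts $|\omega\cap B|$ are Poisson distributed with mean $\nu(B)$ (almost surely infinite if $\nu(B)=\infty$), and counts of disjoint measurable sets are independent. For an action $R$ of $\mathbb G$ on $Y$ let $R_*$ be the action $(R_*)_g\,\omega=\{R_g y: y\in\omega\}$ on $Y^*$. An action is ergodic if every measurable set that is invariant modulo null sets under each group element is null or co-null. A (possibly fractional) Poisson allocation is a measurable map $\Upsilon:X\times X^*\to L^1(\mu)$ such that (A1) $\Upsilon_{(x,\omega)}\ge 0$ for all $(x,\omega)$; (A2) for $\mu^*$-a.e. $\omega$, $\sum_{x\in\omega}\Upsilon_{(x,\omega)}(y)=1$ for $\mu$-a.e. $y$; (A3) $\Upsilon_{(x,\omega)}=0$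 if $x\notin\omega$. An almost-everywhere Poisson allocation is a map $\Upsilon:X\times X^*\to L^1(\mu)$ such that $(x,\omega)\mapsto\Upsilon_{(x,\{x\}\cup\omega)}$ is $\mu\times\mu^*$-a.e. equal to a measurable map, (A1) holds for $\mu^*$-a.e. $\omega$ and all $x\in\omega$, and (A2) holds. In either case $\Upsilon$ is $T$-equivariant if for every $g\in\mathbb G$, for $\mu^*$-a.e. $\omega$ and all $x\in\omega$, one has $\Upsilon_{(T_gx,(T_*)_g\omega)}\circ T_g=\Upsilon_{(x,\omega)}$ $\mu$-a.e. Let $S=T\times T_*$, acting on $(X\times X^*,\mu\times\mu^*)$. If $S\times S_*$, acting on $\big((X\times X^*)\times(X\times X^*)^*,\ (\mu\times\mu^*)\times(\mu\times\mu^*)^*\big)$, is ergodic, then there is no $T$-equivariant Poisson allocation, and there is no $T$-equivariant almost-everywhere Poisson allocation. -/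

import Mathlib

open MeasureTheory Set Filter

/-- The configuration space `X^*`: the countable subsets of `X`. -/
@[ext]
structure CountableConfig (X : Type*) where
  carrier : Set X
  countable : carrier.Countable

namespace CountableConfig

/-- The number `|ω ∩ B|` of points of `ω` in `B`, possibly infinite. -/
noncomputable def count {X : Type*} (B : Set X) (ω : CountableConfig X) : ℕ∞ :=
  (ω.carrier ∩ B).encard

/-- The σ-algebra `𝓑^*`, generated by the events `|ω ∩ B| = n` with `B` measurable and `n : ℕ`. -/
instance instMeasurableSpaceCountableConfig {X : Type*} [MeasurableSpace X] :
    MeasurableSpace (CountableConfig X) :=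
  MeasurableSpace.generateFrom
    {E | ∃ (B : Set X) (n : ℕ), MeasurableSet B ∧ E = {ω | count B ω = n}}

/-- The action `T_*` on configurations: `g • ω = {g • x | x ∈ ω}`. -/
instance instMulActionCountableConfig {G X : Type*} [Group G] [MulAction G X] :
    MulAction G (CountableConfig X) where
  smul g ω := ⟨(fun x => g • x) '' ω.carrier, ω.countable.image _⟩
  one_smul ω := by
    ext x
    change x ∈ (fun x => (1 : G) • x) '' ω.carrier ↔ _
    simp
  mul_smul g h ω := by
    ext x
    change x ∈ (fun x => (g * h) • x) '' ω.carrier ↔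
      x ∈ (fun x => g • x) '' ((fun x => h • x) '' ω.carrier)
    simp only [Set.mem_image, exists_exists_and_eq_and, mul_smul]

/-- The configuration `{x} ∪ ω`. -/
def addPoint {X : Type*} (x : X) (ω : CountableConfig X) : CountableConfig X :=
  ⟨insert x ω.carrier, ω.countable.insert x⟩

end CountableConfig

open CountableConfig

/-- `P` is the law `μ^*` of the Poisson point process with intensity `μ`: the number of points in a
measurable set `B` is Poisson distributed with mean `μ B` (almost surely infinite if `μ B = ∞`), and
the numbers of points in pairwise disjoint measurable sets are jointly independent. -/
structure IsPoissonProcessLaw {X : Type*} [MeasurableSpace X] (μ : Measure X)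
    (P : Measure (CountableConfig X)) : Prop where
  isProbabilityMeasure : IsProbabilityMeasure P
  count_of_ne_top : ∀ B : Set X, MeasurableSet B → μ B ≠ ⊤ → ∀ k : ℕ,
    P {ω | count B ω = k} =
      ENNReal.ofReal (Real.exp (-(μ B).toReal) * (μ B).toReal ^ k / (k.factorial : ℝ))
  count_of_eq_top : ∀ B : Set X, MeasurableSet B → μ B = ⊤ → ∀ᵐ ω ∂P, count B ω = ⊤
  iIndepFun_count : ∀ (n : ℕ) (A : Fin n → Set X), (∀ i, MeasurableSet (A i)) →
    Pairwise (fun i j => Disjoint (A i) (A j)) →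
    ProbabilityTheory.iIndepFun (fun i ω => count (A i) ω) P

/-- A (possibly fractional) Poisson allocation rule `Υ : X × X^* → L¹(μ)`. The representative values
`Υ (x, ω) y` are not required to be `0` or `1`. -/
structure IsPoissonAllocation {X : Type*} [MeasurableSpace X] (μ : Measure X)
    (P : Measure (CountableConfig X)) (Υ : X × CountableConfig X → Lp ℝ 1 μ) : Prop where
  measurable : StronglyMeasurable Υ
  nonneg : ∀ x ω, 0 ≤ Υ (x, ω)
  partition_of_unity : ∀ᵐ ω ∂P, ∀ᵐ y ∂μ, HasSum (fun x : ω.carrier => Υ (x, ω) y) 1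
  eq_zero : ∀ x ω, x ∉ ω.carrier → Υ (x, ω) = 0

/-- A (possibly fractional) Poisson allocation in the almost everywhere sense: `Υ (x, ω)` matters
only for almost every `ω` and the points `x` of `ω`, and measurability is only required up to
modification on a null set of pairs `(x, ω)` with `x ∈ ω`. Null sets of such pairs are those of the
Campbell measure `E ↦ 𝔼 #{x ∈ ω | (x, ω) ∈ E}`, the image of `μ × P` under
`(x, ω) ↦ (x, {x} ∪ ω)`. -/
structure IsAEPoissonAllocation {X : Type*} [MeasurableSpace X] (μ : Measure X)
    (P : Measure (CountableConfig X)) (Υ : X × CountableConfig X → Lp ℝ 1 μ) : Prop where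
  aemeasurable : AEStronglyMeasurable (fun p => Υ (p.1, addPoint p.1 p.2)) (μ.prod P)
  nonneg : ∀ᵐ ω ∂P, ∀ x ∈ ω.carrier, 0 ≤ Υ (x, ω)
  partition_of_unity : ∀ᵐ ω ∂P, ∀ᵐ y ∂μ, HasSum (fun x : ω.carrier => Υ (x, ω) y) 1

/-- Equivariance `Υ_(T x, T_* ω) ∘ T = Υ_(x, ω)`, for each group element, almost every `ω` and all
points `x` of `ω`. -/
def IsEquivariantAllocation (G : Type*) {X : Type*} [Group G] [MulAction G X] [MeasurableSpace X]
    (μ : Measure X) (P : Measure (CountableConfig X))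
    (Υ : X × CountableConfig X → Lp ℝ 1 μ) : Prop :=
  ∀ g : G, ∀ᵐ ω ∂P, ∀ x ∈ ω.carrier,
    (fun y => Υ (g • x, g • ω) (g • y)) =ᵐ[μ] (fun y => Υ (x, ω) y)

/-!
The expected number of pairs `(x, ω)` with `x ∈ ω` and `(x, ω \ {x})` in a given set is its measure
under `μ × P` (the Mecke equation): both sides are measures in that set, and on a rectangle
`A × {η | η ∩ B = ∅}` this is a computation with the counts of `A` and `B`. Hence an allocation `Υ`
amounts to a map `f (x, ω) = Υ (x, {x} ∪ ω)` from `Z = X × X^*` to `L¹(μ)`, defined almost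
everywhere, and `∫ ∫_B |f z| dμ d(μ × P)(z) = μ B`.

If `Υ` is equivariant, then the distances between the values of `f` are invariant. Therefore the
event that no point `z'` of a Poisson process on `Z` has `f z'` within `ε` of `f z` is invariant
under `S × S_*`, and ergodicity makes it null or co-null. In other words, for almost every `z`, the
preimage under `f` of the `ε`-ball around `f z` has measure `0`, or for almost every `z` it has
measure `∞`. Separability of the range of `f` excludes the first case. In the second case every
nonnegative continuous function `φ` on `L¹(μ)` such that `φ ∘ f` is integrable vanishes at almost
every `f z`. Applied to `φ u = ∫_B |u| dμ` with `μ B < ∞`, this gives `μ B = 0`.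
-/

open scoped ENNReal

namespace CountableConfig

variable {X Y G : Type*}

theorem count_eq_zero {B : Set X} {ω : CountableConfig X} :
    count B ω = 0 ↔ ∀ x ∈ ω.carrier, x ∉ B := by
  rw [count, encard_eq_zero, ← disjoint_iff_inter_eq_empty, disjoint_left]

theorem count_empty (ω : CountableConfig X) : count ∅ ω = 0 := by
  simp [count]

theorem count_union {A B : Set X} (h : Disjoint A B) (ω : CountableConfig X) :
    count (A ∪ B) ω = count A ω + count B ω := by
  simp only [count, inter_union_distrib_left]
  exact encard_union_eq (h.mono inter_subset_right inter_subset_right)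

theorem count_addPoint_eq_zero {x : X} {ω : CountableConfig X} {B : Set X} :
    count B (addPoint x ω) = 0 ↔ x ∉ B ∧ count B ω = 0 := by
  simp only [count_eq_zero, addPoint, forall_mem_insert]

/-- The configuration `ω \ {x}`. -/
def erasePoint (x : X) (ω : CountableConfig X) : CountableConfig X :=
  ⟨ω.carrier \ {x}, ω.countable.mono sdiff_subset⟩

theorem addPoint_erasePoint {x : X} {ω : CountableConfig X} (h : x ∈ ω.carrier) :
    addPoint x (erasePoint x ω) = ω :=
  CountableConfig.ext (insert_sdiff_self_of_mem h)

theorem count_erasePoint_of_notMem {x : X} {B : Set X} (h : x ∉ B) (ω : CountableConfig X) :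
    count B (erasePoint x ω) = count B ω := by
  rw [count, count, erasePoint, ← inter_sdiff_right_comm,
    sdiff_singleton_eq_self fun hx => h hx.2]

theorem count_erasePoint_add_one {x : X} {B : Set X} {ω : CountableConfig X}
    (hx : x ∈ ω.carrier) (hB : x ∈ B) : count B (erasePoint x ω) + 1 = count B ω := by
  rw [count, count, erasePoint, ← inter_sdiff_right_comm]
  exact encard_sdiff_singleton_add_one (mem_inter hx hB)

section Action

variable [Group G] [MulAction G X]

theorem count_smul (g : G) (B : Set X) (ω : CountableConfig X) :
    count B (g • ω) = count ((g • ·) ⁻¹' B) ω := by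
  rw [count, count, ← (MulAction.injective g).encard_image (ω.carrier ∩ _),
    image_inter_preimage]
  rfl

theorem smul_addPoint (g : G) (x : X) (ω : CountableConfig X) :
    g • addPoint x ω = addPoint (g • x) (g • ω) :=
  CountableConfig.ext (image_insert_eq ..)

end Action

variable [MeasurableSpace X] [MeasurableSpace Y]

theorem measurable_count {B : Set X} (hB : MeasurableSet B) : Measurable (count B) :=
  ENat.measurable_iff.mpr fun n => MeasurableSpace.measurableSet_generateFrom ⟨B, n, hB, rfl⟩

theorem measurableSet_count_eq {B : Set X} (hB : MeasurableSet B) (n : ℕ∞) :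
    MeasurableSet {ω | count B ω = n} :=
  measurable_count hB (measurableSet_singleton n)

theorem measurable_of_measurable_count {f : Y → CountableConfig X}
    (hf : ∀ B, MeasurableSet B → Measurable fun y => count B (f y)) : Measurable f := by
  refine measurable_generateFrom ?_
  rintro _ ⟨B, n, hB, rfl⟩
  exact hf B hB (measurableSet_singleton (n : ℕ∞))

instance [Group G] [MulAction G X] [MeasurableConstSMul G X] :
    MeasurableConstSMul G (CountableConfig X) where
  measurable_const_smul g := measurable_of_measurable_count fun B hB => by
    simpa only [count_smul] using measurable_count (measurable_const_smul g hB)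

section Dissection

variable [MeasurableSpace.CountablySeparated X]

/-- A dissecting system of the countably separated space `X`: the fibres of `dissection n` form
a finite measurable partition, and these partitions eventually separate any finitely many points.
The value at `x` consists of the first `n` bits of an injective measurable code of `x`. -/
noncomputable def dissection (n : ℕ) (x : X) : Fin n → Bool := fun i =>
  (MeasurableSpace.measurable_injection_nat_bool_of_countablySeparated X).choose x i

theorem measurable_dissection (n : ℕ) : Measurable (dissection n : X → Fin n → Bool) :=
  measurable_pi_lambda _ fun i => (measurable_pi_apply (i : ℕ)).comp
    (MeasurableSpace.measurable_injection_nat_bool_of_countablySeparated X).choose_spec.1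

theorem exists_injOn_dissection {s : Set X} (hs : s.Finite) :
    ∃ n, InjOn (dissection n : X → Fin n → Bool) s := by
  have separate : ∀ x y : X, ∀ᶠ n in atTop, dissection n x = dissection n y → x = y := by
    intro x y
    by_cases hxy : x = y
    · exact Eventually.of_forall fun _ _ => hxy
    obtain ⟨i, hi⟩ := Function.ne_iff.mp
      ((MeasurableSpace.measurable_injection_nat_bool_of_countablySeparated X).choose_spec.2.ne hxy)
    filter_upwards [eventually_gt_atTop i] with n hn h
    exact absurd (congrFun h ⟨i, hn⟩) hi
  exact ((eventually_all_finite hs).mpr fun x _ =>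
    (eventually_all_finite hs).mpr fun y _ => separate x y).exists.imp
      fun n h x hx y hy => h x hx y hy

theorem encard_eq_iSup_encard_image_dissection (s : Set X) :
    s.encard = ⨆ n, (dissection n '' s).encard := by
  refine le_antisymm (ENat.forall_natCast_le_iff_le.mp fun k hk => ?_)
    (iSup_le fun n => encard_image_le _ s)
  obtain ⟨t, hts, ht⟩ := exists_subset_encard_eq hk
  obtain ⟨n, hn⟩ := exists_injOn_dissection (finite_of_encard_eq_coe ht)
  rw [← ht, ← hn.encard_image]
  exact (encard_le_encard (image_mono hts)).trans
    (le_iSup (fun n => (dissection n '' s).encard) n)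

open Classical in
theorem count_eq_iSup_sum_dissection (B : Set X) (ω : CountableConfig X) :
    count B ω = ⨆ n, ∑ c : Fin n → Bool,
      if count (B ∩ dissection n ⁻¹' {c}) ω = 0 then 0 else 1 := by
  have hit : ∀ n (c : Fin n → Bool), c ∈ dissection n '' (ω.carrier ∩ B) ↔
      ¬ count (B ∩ dissection n ⁻¹' {c}) ω = 0 := by
    intro n c
    simp only [count_eq_zero, mem_image, mem_inter_iff, mem_preimage, mem_singleton_iff]
    grind
  rw [count, encard_eq_iSup_encard_image_dissection]
  refine iSup_congr fun n => ?_
  rw [encard_eq_coe_toFinset_card, toFinset_card, Fintype.card_subtype, Finset.card_filter,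
    Nat.cast_sum]
  refine Finset.sum_congr rfl fun c _ => ?_
  simp [hit]

/-- The number of points in `B` is the limit of the number of occupied cells of `B`, so that
the σ-algebra of configurations is generated by the void events. -/
theorem measurable_of_measurableSet_count_eq_zero {f : Y → CountableConfig X}
    (hf : ∀ B, MeasurableSet B → MeasurableSet {y | count B (f y) = 0}) : Measurable f := by
  classical
  have : BorelSpace ℕ∞ := ⟨borel_eq_top_of_countable.symm⟩
  refine measurable_of_measurable_count fun B hB => ?_
  simp only [count_eq_iSup_sum_dissection B]
  refine Measurable.iSup fun n => Finset.measurable_fun_sum _ fun c _ => Measurable.ite (hf _ ?_)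
    measurable_const measurable_const
  exact hB.inter (measurable_dissection n (measurableSet_singleton c))

theorem measurable_addPoint :
    Measurable fun z : X × CountableConfig X => addPoint z.1 z.2 := by
  refine measurable_of_measurableSet_count_eq_zero fun B hB => ?_
  simp only [count_addPoint_eq_zero]
  exact (measurable_fst hB.compl).inter (measurable_snd (measurableSet_count_eq hB 0))

end Dissection

/-- The void events `{ω | ω ∩ B = ∅}` with `B` measurable, a generating π-system on which measures
on the configuration space are compared. -/
def voidEvents (X : Type*) [MeasurableSpace X] : Set (Set (CountableConfig X)) :=
  {E | ∃ B, MeasurableSet B ∧ E = {ω | count B ω = 0}}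

theorem univ_mem_voidEvents : univ ∈ voidEvents X :=
  ⟨∅, .empty, by simp [count_empty]⟩

theorem isPiSystem_voidEvents : IsPiSystem (voidEvents X) := by
  rintro _ ⟨A, hA, rfl⟩ _ ⟨B, hB, rfl⟩ -
  refine ⟨A ∪ B, hA.union hB, ?_⟩
  ext ω
  simp only [mem_inter_iff, mem_ofPred_eq, count_eq_zero, mem_union]
  grind

theorem generateFrom_voidEvents [MeasurableSpace.CountablySeparated X] :
    MeasurableSpace.generateFrom (voidEvents X) = instMeasurableSpaceCountableConfig := by
  refine le_antisymm (MeasurableSpace.generateFrom_le ?_) ?_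
  · rintro _ ⟨B, hB, rfl⟩
    exact measurableSet_count_eq hB 0
  · have measurable_id := @measurable_of_measurableSet_count_eq_zero X (CountableConfig X) _
      (MeasurableSpace.generateFrom (voidEvents X)) _ id
      fun B hB => MeasurableSpace.measurableSet_generateFrom ⟨B, hB, rfl⟩
    exact fun E hE => measurable_id hE

/-- The sum of the point masses at the pairs `(x, ω \ {x})` with `x ∈ ω`. Its mean under a law of
`ω` is the reduced Campbell measure of that law. -/
noncomputable def erasureMeasure (ω : CountableConfig X) : Measure (X × CountableConfig X) :=
  Measure.sum fun x : ω.carrier => Measure.dirac (x.1, erasePoint x.1 ω)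

theorem lintegral_erasureMeasure {F : X × CountableConfig X → ℝ≥0∞} (hF : Measurable F)
    (ω : CountableConfig X) :
    ∫⁻ z, F z ∂erasureMeasure ω = ∑' x : ω.carrier, F (x.1, erasePoint x.1 ω) := by
  simp only [erasureMeasure, lintegral_sum_measure, lintegral_dirac' _ hF]

theorem erasureMeasure_apply {ω : CountableConfig X} {E : Set (X × CountableConfig X)}
    (hE : MeasurableSet E) :
    erasureMeasure ω E = (ω.carrier ∩ {x | (x, erasePoint x ω) ∈ E}).encard := by
  rw [← lintegral_indicator_one hE, lintegral_erasureMeasure (measurable_one.indicator hE),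
    ← ENNReal.tsum_set_one, tsum_subtype ω.carrier fun x => E.indicator 1 (x, erasePoint x ω),
    tsum_subtype _ fun _ => 1, ← indicator_indicator]
  rfl

theorem erasureMeasure_preimage_fst {A : Set X} (hA : MeasurableSet A) (ω : CountableConfig X) :
    erasureMeasure ω (Prod.fst ⁻¹' A) = count A ω :=
  erasureMeasure_apply (measurable_fst hA)

/-- If `ω \ {x}` misses `B`, then either `ω` misses `B`, or `x` is the only point of `ω` in `B`. -/
theorem erasureMeasure_prod_void {A B : Set X} (hA : MeasurableSet A) (hB : MeasurableSet B)
    (ω : CountableConfig X) :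
    erasureMeasure ω (A ×ˢ {η | count B η = 0}) =
      {η | count B η = 0}.indicator (fun η => (count (A \ B) η : ℝ≥0∞)) ω +
        {η | count B η = 1}.indicator (fun η => (count (A ∩ B) η : ℝ≥0∞)) ω := by
  have erase_void : ∀ x ∈ ω.carrier, (count B (erasePoint x ω) = 0 ↔
      (x ∉ B ∧ count B ω = 0) ∨ (x ∈ B ∧ count B ω = 1)) := by
    intro x hx
    by_cases hxB : x ∈ B
    · rw [← count_erasePoint_add_one hx hxB]
      simp [hxB]
    · simp [hxB, count_erasePoint_of_notMem hxB]
  rw [erasureMeasure_apply (hA.prod (measurableSet_count_eq hB 0))]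
  by_cases h0 : count B ω = 0
  · have trace : ω.carrier ∩ {x | (x, erasePoint x ω) ∈ A ×ˢ {η | count B η = 0}} =
        ω.carrier ∩ (A \ B) := by
      ext x
      have := erase_void x
      simp_all
    rw [trace, ← count]
    simp [h0]
  by_cases h1 : count B ω = 1
  · have trace : ω.carrier ∩ {x | (x, erasePoint x ω) ∈ A ×ˢ {η | count B η = 0}} =
        ω.carrier ∩ (A ∩ B) := by
      ext x
      have := erase_void x
      simp_all
    rw [trace, ← count]
    simp [h1]
  · have trace : ω.carrier ∩ {x | (x, erasePoint x ω) ∈ A ×ˢ {η | count B η = 0}} = ∅ := by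
      ext x
      have := erase_void x
      simp_all
    rw [trace]
    simp [h0, h1]

theorem measurable_coe_count {B : Set X} (hB : MeasurableSet B) :
    Measurable fun ω => (count B ω : ℝ≥0∞) :=
  Measurable.of_discrete.comp (measurable_count hB)

theorem measurable_erasureMeasure_prod_void {A B : Set X} (hA : MeasurableSet A)
    (hB : MeasurableSet B) : Measurable fun ω => erasureMeasure ω (A ×ˢ {η | count B η = 0}) := by
  simp only [erasureMeasure_prod_void hA hB]
  exact ((measurable_coe_count (hA.diff hB)).indicator (measurableSet_count_eq hB 0)).add
    ((measurable_coe_count (hA.inter hB)).indicator (measurableSet_count_eq hB 1))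

section Restrict

variable [MeasurableSpace.CountablySeparated X]

theorem measurable_erasureMeasure_restrict {A : Set X} (hA : MeasurableSet A) :
    Measurable ({ω | count A ω ≠ ⊤}.indicator fun ω =>
      (erasureMeasure ω).restrict (Prod.fst ⁻¹' A)) := by
  have finite : ∀ ω, IsFiniteMeasure ({ω | count A ω ≠ ⊤}.indicator (fun ω =>
      (erasureMeasure ω).restrict (Prod.fst ⁻¹' A)) ω) := by
    intro ω
    by_cases h : count A ω = ⊤
    · simp only [indicator, mem_ofPred_eq, h, ne_eq, not_true, if_false]
      infer_instance
    · rw [indicator_of_mem (show ω ∈ {ω | count A ω ≠ ⊤} from h), isFiniteMeasure_restrict,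
        erasureMeasure_preimage_fst hA]
      simpa using h
  have generate : (Prod.instMeasurableSpace : MeasurableSpace (X × CountableConfig X)) =
      MeasurableSpace.generateFrom (image2 (· ×ˢ ·) {s | MeasurableSet s} (voidEvents X)) :=
    (generateFrom_eq_prod MeasurableSpace.generateFrom_measurableSet generateFrom_voidEvents
      isCountablySpanning_measurableSet ⟨fun _ => univ, fun _ => univ_mem_voidEvents,
        iUnion_const _⟩).symm
  refine Measurable.measure_of_isPiSystem generate
    (MeasurableSpace.isPiSystem_measurableSet.prod isPiSystem_voidEvents) ?_ ?_
  · rintro _ ⟨D, hD, _, ⟨B, hB, rfl⟩, rfl⟩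
    convert (measurable_erasureMeasure_prod_void (hD.inter hA) hB).indicator
      (measurableSet_count_eq hA ⊤).compl using 2 with ω
    by_cases h : count A ω = ⊤
    · simp [h]
    · have slice : (D ×ˢ {η | count B η = 0} ∩ Prod.fst ⁻¹' A : Set (X × CountableConfig X)) =
          (D ∩ A) ×ˢ {η | count B η = 0} := by
        ext z
        simp only [mem_inter_iff, mem_prod, mem_preimage, and_right_comm]
      simp [h, Measure.restrict_apply (hD.prod (measurableSet_count_eq hB 0)), slice]
  · convert (measurable_coe_count hA).indicator (measurableSet_count_eq hA ⊤).compl using 2 with ω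
    by_cases h : count A ω = ⊤ <;> simp [h, erasureMeasure_preimage_fst hA]

end Restrict

end CountableConfig

namespace IsPoissonProcessLaw

variable {X : Type*} [MeasurableSpace X] {μ : Measure X} {P : Measure (CountableConfig X)}
  {A B : Set X}

theorem prob_count_eq_zero (hP : IsPoissonProcessLaw μ P) (hB : MeasurableSet B) (h : μ B ≠ ⊤) :
    P {ω | count B ω = 0} = ENNReal.ofReal (Real.exp (-(μ B).toReal)) := by
  simpa using hP.count_of_ne_top B hB h 0

theorem ae_count_eq_zero_iff (hP : IsPoissonProcessLaw μ P) (hB : MeasurableSet B) :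
    (∀ᵐ ω ∂P, count B ω = 0) ↔ μ B = 0 := by
  have := hP.isProbabilityMeasure
  by_cases hT : μ B = ⊤
  · refine iff_of_false (fun h => ?_) (by simp [hT])
    obtain ⟨ω, h0, h1⟩ := (h.and (hP.count_of_eq_top B hB hT)).exists
    simp [h0] at h1
  · refine (mem_ae_iff_prob_eq_one (measurableSet_count_eq hB 0)).trans ?_
    rw [hP.prob_count_eq_zero hB hT, ENNReal.ofReal_eq_one, Real.exp_eq_one_iff, neg_eq_zero,
      ENNReal.toReal_eq_zero_iff, or_iff_left hT]

theorem ae_count_ne_zero_iff (hP : IsPoissonProcessLaw μ P) (hB : MeasurableSet B) :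
    (∀ᵐ ω ∂P, count B ω ≠ 0) ↔ μ B = ⊤ := by
  refine ⟨fun h => ?_, fun h => ?_⟩
  · by_contra hT
    have void : P {ω | count B ω = 0} = 0 := by simpa [ae_iff] using h
    rw [hP.prob_count_eq_zero hB hT, ENNReal.ofReal_eq_zero] at void
    exact void.not_gt (Real.exp_pos _)
  · filter_upwards [hP.count_of_eq_top B hB h] with ω hω
    simp [hω]

theorem ae_forall_mem (hP : IsPoissonProcessLaw μ P) {p : X → Prop} (hp : ∀ᵐ x ∂μ, p x) :
    ∀ᵐ ω ∂P, ∀ x ∈ ω.carrier, p x := by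
  filter_upwards [(hP.ae_count_eq_zero_iff (measurableSet_toMeasurable μ {x | ¬ p x})).mpr
    (by rw [measure_toMeasurable]; exact hp)] with ω hω x hx
  by_contra h
  exact count_eq_zero.mp hω x hx (subset_toMeasurable μ _ h)

theorem succ_mul_prob_count (hP : IsPoissonProcessLaw μ P) (hB : MeasurableSet B)
    (hT : μ B ≠ ⊤) (k : ℕ) :
    ((k + 1 : ℕ) : ℝ≥0∞) * P {ω | count B ω = (k + 1 : ℕ)} = μ B * P {ω | count B ω = k} := by
  rw [hP.count_of_ne_top B hB hT, hP.count_of_ne_top B hB hT, ← ENNReal.ofReal_natCast,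
    ← ENNReal.ofReal_mul (by positivity), ← ENNReal.ofReal_toReal hT, ENNReal.toReal_ofReal
    (by positivity), ← ENNReal.ofReal_mul (by positivity), Nat.factorial_succ]
  congr 1
  push_cast
  field_simp
  ring

theorem prob_count_eq_one (hP : IsPoissonProcessLaw μ P) (hB : MeasurableSet B) :
    P {ω | count B ω = 1} = μ B * P {ω | count B ω = 0} := by
  by_cases hT : μ B = ⊤
  · have null : ∀ n : ℕ∞, n ≠ ⊤ → P {ω | count B ω = n} = 0 := fun n hn =>
      measure_eq_zero_iff_ae_notMem.mpr <| (hP.count_of_eq_top B hB hT).mono fun ω hω h =>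
        hn (h.symm.trans hω)
    rw [null 1 (by decide), null 0 (by decide), mul_zero]
  · simpa using hP.succ_mul_prob_count hB hT 0

theorem tsum_prob_count (hP : IsPoissonProcessLaw μ P) (hB : MeasurableSet B) (hT : μ B ≠ ⊤) :
    ∑' k : ℕ, P {ω | count B ω = k} = 1 := by
  have poisson : HasSum
      (fun k : ℕ => Real.exp (-(μ B).toReal) * (μ B).toReal ^ k / k.factorial) 1 :=
    ProbabilityTheory.hasSum_one_poissonMeasure (μ B).toNNReal
  simp_rw [hP.count_of_ne_top B hB hT]
  rw [← ENNReal.ofReal_tsum_of_nonneg (fun k => by positivity) poisson.summable,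
    poisson.tsum_eq, ENNReal.ofReal_one]

theorem ae_count_ne_top (hP : IsPoissonProcessLaw μ P) (hB : MeasurableSet B) (hT : μ B ≠ ⊤) :
    ∀ᵐ ω ∂P, count B ω ≠ ⊤ := by
  have := hP.isProbabilityMeasure
  have finite : {ω | count B ω ≠ ⊤} = ⋃ k : ℕ, {ω | count B ω = k} := by
    ext ω
    simp [ENat.ne_top_iff_exists, eq_comm]
  refine (mem_ae_iff_prob_eq_one (measurableSet_count_eq hB ⊤).compl).mpr ?_
  change P {ω | count B ω ≠ ⊤} = 1
  rw [finite, measure_iUnion _ fun k : ℕ => measurableSet_count_eq hB k, hP.tsum_prob_count hB hT]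
  exact fun i j hij => disjoint_left.mpr fun ω hi hj => hij (Nat.cast_inj.mp (hi.symm.trans hj))

theorem lintegral_count (hP : IsPoissonProcessLaw μ P) (hB : MeasurableSet B) :
    ∫⁻ ω, count B ω ∂P = μ B := by
  have := hP.isProbabilityMeasure
  by_cases hT : μ B = ⊤
  · rw [lintegral_congr_ae ((hP.count_of_eq_top B hB hT).mono fun ω hω => congrArg _ hω)]
    simp [hT]
  have level_sum : ∀ᵐ ω ∂P, (count B ω : ℝ≥0∞) =
      ∑' k : ℕ, {ω | count B ω = (k + 1 : ℕ)}.indicator (fun _ => ((k + 1 : ℕ) : ℝ≥0∞)) ω := by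
    filter_upwards [hP.ae_count_ne_top hB hT] with ω hω
    obtain ⟨n, hn⟩ := ENat.ne_top_iff_exists.mp hω
    rcases n with _ | n
    · simp [← hn, indicator, eq_comm (a := (0 : ℕ∞))]
    · rw [tsum_eq_single n fun k hk => indicator_of_notMem (by
        rw [mem_ofPred_eq, ← hn]; exact_mod_cast fun h => hk (by omega)) _]
      simp [← hn]
  rw [lintegral_congr_ae level_sum, lintegral_tsum fun k =>
    (measurable_const.indicator (measurableSet_count_eq hB _)).aemeasurable]
  simp_rw [lintegral_indicator_const (measurableSet_count_eq hB _), hP.succ_mul_prob_count hB hT]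
  rw [ENNReal.tsum_mul_left, hP.tsum_prob_count hB hT, mul_one]

theorem indepFun_count (hP : IsPoissonProcessLaw μ P) (hA : MeasurableSet A)
    (hB : MeasurableSet B) (h : Disjoint A B) :
    ProbabilityTheory.IndepFun (count A) (count B) P := by
  refine (hP.iIndepFun_count 2 ![A, B] ?_ ?_).indepFun (i := 0) (j := 1) (by decide)
  · simpa [Fin.forall_fin_two] using ⟨hA, hB⟩
  · simpa [Pairwise, Fin.forall_fin_two] using ⟨h, h.symm⟩

theorem prob_count_union_eq_zero (hP : IsPoissonProcessLaw μ P) (hA : MeasurableSet A)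
    (hB : MeasurableSet B) (h : Disjoint A B) :
    P {ω | count (A ∪ B) ω = 0} = P {ω | count A ω = 0} * P {ω | count B ω = 0} := by
  simp only [count_union h, add_eq_zero]
  exact (hP.indepFun_count hA hB h).measure_inter_preimage_eq_mul {0} {0} (.singleton 0)
    (.singleton 0)

theorem lintegral_indicator_count_eq_zero (hP : IsPoissonProcessLaw μ P) (hA : MeasurableSet A)
    (hB : MeasurableSet B) (h : Disjoint A B) :
    ∫⁻ ω, {ω | count B ω = 0}.indicator (fun ω => (count A ω : ℝ≥0∞)) ω ∂P =
      μ A * P {ω | count B ω = 0} := by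
  have void : Measurable (({0} : Set ℕ∞).indicator (1 : ℕ∞ → ℝ≥0∞)) := .of_discrete
  have indep := (hP.indepFun_count hA hB h).comp (φ := ((↑) : ℕ∞ → ℝ≥0∞)) .of_discrete void
  calc
    _ = ∫⁻ ω, count A ω * ({0} : Set ℕ∞).indicator 1 (count B ω) ∂P := by
      simp [indicator]
    _ = μ A * ∫⁻ ω, ({0} : Set ℕ∞).indicator 1 (count B ω) ∂P := by
      rw [← hP.lintegral_count hA]
      exact ProbabilityTheory.lintegral_mul_eq_lintegral_mul_lintegral_of_indepFun''
        (measurable_coe_count hA).aemeasurable (void.comp (measurable_count hB)).aemeasurable indep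
    _ = μ A * P {ω | count B ω = 0} := by
      rw [← lintegral_indicator_one (measurableSet_count_eq hB 0)]
      rfl

theorem lintegral_indicator_count_eq_one (hP : IsPoissonProcessLaw μ P) (hA : MeasurableSet A)
    (hB : MeasurableSet B) (h : A ⊆ B) :
    ∫⁻ ω, {ω | count B ω = 1}.indicator (fun ω => (count A ω : ℝ≥0∞)) ω ∂P =
      μ A * P {ω | count B ω = 0} := by
  have count_B : ∀ ω, count B ω = count A ω + count (B \ A) ω := fun ω => by
    rw [← count_union disjoint_sdiff_right, union_sdiff_cancel h]
  have one_zero : ∀ a b : ℕ∞, (if a + b = 1 then (a : ℝ≥0∞) else 0) =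
      if a = 1 ∧ b = 0 then 1 else 0 := by
    intro a b
    induction a using ENat.recTopCoe with
    | top => simp
    | coe m =>
      induction b using ENat.recTopCoe with
      | top => simp
      | coe n =>
        norm_cast
        have : m + n = 1 ↔ m = 1 ∧ n = 0 ∨ m = 0 ∧ n = 1 := by omega
        simp only [this]
        aesop
  calc
    _ = ∫⁻ ω, ({ω | count A ω = 1} ∩ {ω | count (B \ A) ω = 0}).indicator 1 ω ∂P := by
      simp [indicator, count_B, one_zero]
    _ = P ({ω | count A ω = 1} ∩ {ω | count (B \ A) ω = 0}) := lintegral_indicator_one <|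
      (measurableSet_count_eq hA 1).inter (measurableSet_count_eq (hB.diff hA) 0)
    _ = P {ω | count A ω = 1} * P {ω | count (B \ A) ω = 0} :=
      (hP.indepFun_count hA (hB.diff hA) disjoint_sdiff_right).measure_inter_preimage_eq_mul
        {1} {0} (.singleton 1) (.singleton 0)
    _ = μ A * P {ω | count B ω = 0} := by
      rw [hP.prob_count_eq_one hA, mul_assoc, ← hP.prob_count_union_eq_zero hA (hB.diff hA)
        disjoint_sdiff_right, union_sdiff_cancel h]

theorem lintegral_erasureMeasure_prod_void (hP : IsPoissonProcessLaw μ P) (hA : MeasurableSet A)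
    (hB : MeasurableSet B) :
    ∫⁻ ω, erasureMeasure ω (A ×ˢ {η | count B η = 0}) ∂P = μ A * P {ω | count B ω = 0} := by
  simp only [erasureMeasure_prod_void hA hB]
  rw [lintegral_add_left ((measurable_coe_count (hA.diff hB)).indicator
      (measurableSet_count_eq hB 0)),
    hP.lintegral_indicator_count_eq_zero (hA.diff hB) hB disjoint_sdiff_left,
    hP.lintegral_indicator_count_eq_one (hA.inter hB) hB inter_subset_right, ← add_mul,
    measure_sdiff_add_inter A hB]

theorem aemeasurable_erasureMeasure [MeasurableSpace.CountablySeparated X] [SigmaFinite μ]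
    (hP : IsPoissonProcessLaw μ P) : AEMeasurable erasureMeasure P := by
  let T := disjointed (spanningSets μ)
  have hT : ∀ n, MeasurableSet (T n) := MeasurableSet.disjointed (measurableSet_spanningSets μ)
  refine ⟨fun ω => Measure.sum fun n => {ω | count (T n) ω ≠ ⊤}.indicator
    (fun ω => (erasureMeasure ω).restrict (Prod.fst ⁻¹' T n)) ω, ?_, ?_⟩
  · refine Measure.measurable_of_measurable_coe _ fun E hE => ?_
    simp only [Measure.sum_apply _ hE]
    exact Measurable.tsum fun n =>
      (Measure.measurable_coe hE).comp (measurable_erasureMeasure_restrict (hT n))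
  · filter_upwards [ae_all_iff.mpr fun n => hP.ae_count_ne_top (hT n)
      ((measure_mono (disjointed_subset _ n)).trans_lt (measure_spanningSets_lt_top μ n)).ne]
      with ω hω
    have cover : ⋃ n, (Prod.fst ⁻¹' T n : Set (X × CountableConfig X)) = univ := by
      rw [← preimage_iUnion, iUnion_disjointed, iUnion_spanningSets, preimage_univ]
    simp only [indicator, mem_ofPred_eq, hω, not_false_eq_true, ne_eq, if_true]
    rw [← Measure.restrict_iUnion (fun i j hij => (disjoint_disjointed _ hij).preimage _)
      (fun n => measurable_fst (hT n)), cover, Measure.restrict_univ]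

theorem mecke_equation [MeasurableSpace.CountablySeparated X] [SigmaFinite μ]
    (hP : IsPoissonProcessLaw μ P) : P.bind erasureMeasure = μ.prod P := by
  have := hP.isProbabilityMeasure
  refine (Measure.prod_eq_generateFrom MeasurableSpace.generateFrom_measurableSet
    generateFrom_voidEvents MeasurableSpace.isPiSystem_measurableSet isPiSystem_voidEvents
    μ.toFiniteSpanningSetsIn
    ⟨fun _ => univ, fun _ => univ_mem_voidEvents, fun _ => measure_lt_top P _, iUnion_const _⟩
    ?_).symm
  rintro A hA _ ⟨B, hB, rfl⟩
  rw [Measure.bind_apply (hA.prod (measurableSet_count_eq hB 0)) hP.aemeasurable_erasureMeasure]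
  exact hP.lintegral_erasureMeasure_prod_void hA hB

section Mecke

variable [MeasurableSpace.CountablySeparated X] [SigmaFinite μ]

theorem ae_prod_iff_ae_forall_mem_erasePoint (hP : IsPoissonProcessLaw μ P)
    {p : X × CountableConfig X → Prop} (hp : MeasurableSet {z | ¬ p z}) :
    (∀ᵐ z ∂μ.prod P, p z) ↔ ∀ᵐ ω ∂P, ∀ x ∈ ω.carrier, p (x, erasePoint x ω) := by
  rw [ae_iff, ← hP.mecke_equation, Measure.bind_apply hp hP.aemeasurable_erasureMeasure]
  refine (lintegral_eq_zero_iff' ((Measure.measurable_coe hp).comp_aemeasurable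
    hP.aemeasurable_erasureMeasure)).trans ?_
  refine eventually_congr (Eventually.of_forall fun ω => ?_)
  simp [erasureMeasure_apply hp, eq_empty_iff_forall_notMem]

theorem ae_forall_mem_erasePoint (hP : IsPoissonProcessLaw μ P)
    {p : X × CountableConfig X → Prop} (hp : ∀ᵐ z ∂μ.prod P, p z) :
    ∀ᵐ ω ∂P, ∀ x ∈ ω.carrier, p (x, erasePoint x ω) := by
  set N := toMeasurable (μ.prod P) {z | ¬ p z}
  have hN : ∀ᵐ z ∂μ.prod P, z ∉ N :=
    measure_eq_zero_iff_ae_notMem.mp ((measure_toMeasurable _).trans hp)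
  filter_upwards [(hP.ae_prod_iff_ae_forall_mem_erasePoint (p := (· ∉ N))
    (measurableSet_toMeasurable _ _).compl.compl).mp hN] with ω hω x hx
  by_contra h
  exact hω x hx (subset_toMeasurable _ _ h)

theorem lintegral_tsum_erasePoint (hP : IsPoissonProcessLaw μ P)
    {F : X × CountableConfig X → ℝ≥0∞} (hF : AEMeasurable F (μ.prod P)) :
    ∫⁻ ω, ∑' x : ω.carrier, F (x.1, erasePoint x.1 ω) ∂P = ∫⁻ z, F z ∂μ.prod P := by
  obtain ⟨F', hF', hFF'⟩ := hF
  have modify : ∀ᵐ ω ∂P, ∑' x : ω.carrier, F (x.1, erasePoint x.1 ω) =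
      ∑' x : ω.carrier, F' (x.1, erasePoint x.1 ω) := by
    filter_upwards [hP.ae_forall_mem_erasePoint hFF'] with ω hω
    exact tsum_congr fun x => hω x x.2
  rw [lintegral_congr_ae modify, lintegral_congr_ae hFF', ← hP.mecke_equation,
    Measure.lintegral_bind hP.aemeasurable_erasureMeasure hF'.aemeasurable]
  exact lintegral_congr fun ω => (lintegral_erasureMeasure hF' ω).symm

theorem quasiMeasurePreserving_addPoint (hP : IsPoissonProcessLaw μ P) :
    Measure.QuasiMeasurePreserving (fun z => addPoint z.1 z.2) (μ.prod P) P := by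
  refine ⟨measurable_addPoint, Measure.AbsolutelyContinuous.mk fun N hN h0 => ?_⟩
  rw [Measure.map_apply measurable_addPoint hN, measure_eq_zero_iff_ae_notMem]
  refine (hP.ae_prod_iff_ae_forall_mem_erasePoint (p := fun z => addPoint z.1 z.2 ∉ N)
    (measurable_addPoint hN).compl.compl).mpr ?_
  filter_upwards [measure_eq_zero_iff_ae_notMem.mp h0] with ω hω x hx
  rwa [addPoint_erasePoint hx]

end Mecke

end IsPoissonProcessLaw

section Ergodic

variable {G Y Z E : Type*} [Group G] [MulAction G Y] [MulAction G Z] [MeasurableSpace Y]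
  [MeasurableSpace Z] [PseudoMetricSpace E]

instance [MeasurableConstSMul G Y] [MeasurableConstSMul G Z] : MeasurableConstSMul G (Y × Z) where
  measurable_const_smul g := ((measurable_const_smul g).comp measurable_fst).prodMk
    ((measurable_const_smul g).comp measurable_snd)

theorem smulInvariantMeasure_of_prod {μ : Measure Y} {ν : Measure Z} [IsProbabilityMeasure ν]
    [SMulInvariantMeasure G (Y × Z) (μ.prod ν)] : SMulInvariantMeasure G Y μ where
  measure_preimage_smul g s hs := by
    have invariant := measure_preimage_smul_of_nullMeasurableSet (μ := μ.prod ν)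
      (hs.prod .univ).nullMeasurableSet g
    have cylinder : (g • ·) ⁻¹' (s ×ˢ (univ : Set Z)) = ((g • ·) ⁻¹' s) ×ˢ univ := by
      ext
      simp
    simpa [cylinder] using invariant

theorem measurableSet_preimage_ball {f : Z → E} (hf : StronglyMeasurable f) (u : E) (ε : ℝ) :
    MeasurableSet (f ⁻¹' Metric.ball u ε) :=
  measurableSet_lt (hf.dist stronglyMeasurable_const).measurable measurable_const

/-- The pairs of a point `z` and a configuration none of whose points `z'` has `f z'` within `ε` of
`f z`. This is the event to which ergodicity is applied. -/
def isolatedPairs (f : Z → E) (ε : ℝ) : Set (Z × CountableConfig Z) :=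
  {w | count (f ⁻¹' Metric.ball (f w.1) ε) w.2 = 0}

/-- The relation `dist (f z) (f z') < ε` is a countable union of measurable rectangles. -/
theorem measurableSet_isolatedPairs {f : Z → E} (hf : StronglyMeasurable f) (ε : ℝ) :
    MeasurableSet (isolatedPairs f ε) := by
  obtain ⟨D, hD, hfD⟩ := hf.isSeparable_range
  have rectangles : isolatedPairs f ε = ⋂ d ∈ D, ⋂ q : ℚ, ({z | dist (f z) d + q < ε}ᶜ ×ˢ univ) ∪
        (univ ×ˢ {ω | count (f ⁻¹' Metric.ball d q) ω = 0}) := by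
    ext ⟨z, ω⟩
    simp only [isolatedPairs, mem_ofPred_eq, mem_iInter, mem_union, mem_prod, mem_univ, and_true,
      true_and, mem_compl_iff, ← imp_iff_not_or, count_eq_zero, mem_preimage, Metric.mem_ball]
    refine ⟨fun h d _ q hq z' hz' hd => h z' hz' ?_, fun h z' hz' hd => ?_⟩
    · linarith [dist_triangle_right (f z') (f z) d]
    · obtain ⟨d, hdD, hd'⟩ := Metric.mem_closure_iff.mp (hfD (mem_range_self z'))
        ((ε - dist (f z') (f z)) / 2) (by linarith)
      obtain ⟨q, hq1, hq2⟩ := exists_rat_btwn hd'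
      refine h d hdD q ?_ z' hz' hq1
      linarith [dist_triangle_left (f z) d (f z'), dist_comm (f z) (f z')]
  rw [rectangles]
  refine MeasurableSet.biInter hD fun d _ => MeasurableSet.iInter fun q => ?_
  refine (MeasurableSet.prod ?_ .univ).union (MeasurableSet.univ.prod ?_)
  · exact (measurableSet_lt ((hf.dist stronglyMeasurable_const).measurable.add_const _)
      measurable_const).compl
  · exact measurableSet_count_eq (measurableSet_preimage_ball hf d q) 0

theorem ae_measure_preimage_ball_ne_zero {ν : Measure Z} {f : Z → E}
    (hf : TopologicalSpace.IsSeparable (range f)) {ε : ℝ} (hε : 0 < ε) :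
    ∀ᵐ z ∂ν, ν (f ⁻¹' Metric.ball (f z) ε) ≠ 0 := by
  obtain ⟨D, hD, hfD⟩ := hf
  have avoid_null : ∀ᵐ z ∂ν, ∀ d ∈ D, ν (f ⁻¹' Metric.ball d (ε / 2)) = 0 →
      z ∉ f ⁻¹' Metric.ball d (ε / 2) :=
    (ae_ball_iff hD).mpr fun d _ => by
      by_cases hd : ν (f ⁻¹' Metric.ball d (ε / 2)) = 0
      · exact (measure_eq_zero_iff_ae_notMem.mp hd).mono fun _ h _ => h
      · exact Eventually.of_forall fun _ h => absurd h hd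
  filter_upwards [avoid_null] with z hz h0
  obtain ⟨d, hdD, hd⟩ := Metric.mem_closure_iff.mp (hfD (mem_range_self z)) (ε / 2) (half_pos hε)
  refine hz d hdD (measure_mono_null (preimage_mono (Metric.ball_subset_ball' ?_)) h0) hd
  rw [dist_comm]
  linarith

theorem eq_zero_of_measure_preimage_ball_eq_top {ν : Measure Z} {f : Z → E}
    (hf : StronglyMeasurable f) {φ : E → ℝ≥0∞} (hφ : Continuous φ)
    (hint : ∫⁻ z, φ (f z) ∂ν ≠ ⊤) {u : E}
    (hu : ∀ ε > 0, ν (f ⁻¹' Metric.ball u ε) = ⊤) : φ u = 0 := by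
  by_contra h
  obtain ⟨c, hc0, hc⟩ := exists_between (pos_iff_ne_zero.mpr h)
  obtain ⟨ε, hε, hball⟩ := Metric.mem_nhds_iff.mp (hφ.continuousAt.eventually_const_lt hc)
  have large : ν {z | c ≤ φ (f z)} = ⊤ :=
    measure_mono_top (fun z hz => show c ≤ φ (f z) from le_of_lt (hball hz)) (hu ε hε)
  have markov : ν {z | c ≤ φ (f z)} ≤ (∫⁻ z, φ (f z) ∂ν) / c := meas_ge_le_lintegral_div
    (hφ.comp_stronglyMeasurable hf).measurable.aemeasurable hc0.ne' hc.ne_top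
  exact (markov.trans_lt (ENNReal.div_lt_top hint hc0.ne')).ne large

variable [MeasurableConstSMul G Z] {ν : Measure Z} {Q : Measure (CountableConfig Z)}

theorem IsPoissonProcessLaw.preimage_smul_isolatedPairs_ae_eq (hQ : IsPoissonProcessLaw ν Q)
    {f : Z → E} (hf : StronglyMeasurable f) {g : G}
    (hg : ∀ᵐ z ∂ν, ∀ᵐ z' ∂ν, dist (f (g • z)) (f (g • z')) = dist (f z) (f z')) (ε : ℝ) :
    (g • ·) ⁻¹' isolatedPairs f ε =ᵐ[ν.prod Q] isolatedPairs f ε := by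
  have := hQ.isProbabilityMeasure
  have hS := measurableSet_isolatedPairs hf ε
  refine eventuallyEq_set.mpr <| (Measure.ae_prod_iff_ae_ae
    ((measurable_const_smul g hS).mem.iff hS.mem).setOf).mpr ?_
  filter_upwards [hg] with z hz
  filter_upwards [hQ.ae_forall_mem hz] with ω hω
  change count (f ⁻¹' Metric.ball (f (g • z)) ε) (g • ω) = 0 ↔
    count (f ⁻¹' Metric.ball (f z) ε) ω = 0
  rw [count_smul, count_eq_zero, count_eq_zero]
  refine forall₂_congr fun z' hz' => ?_
  simp only [mem_preimage, Metric.mem_ball', hω z' hz']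

variable [ErgodicSMul G (Z × CountableConfig Z) (ν.prod Q)]

theorem IsPoissonProcessLaw.ae_measure_preimage_ball_eq_zero_or_top
    (hQ : IsPoissonProcessLaw ν Q) {f : Z → E} (hf : StronglyMeasurable f)
    (hfG : ∀ g : G, ∀ᵐ z ∂ν, ∀ᵐ z' ∂ν, dist (f (g • z)) (f (g • z')) = dist (f z) (f z')) (ε : ℝ) :
    (∀ᵐ z ∂ν, ν (f ⁻¹' Metric.ball (f z) ε) = 0) ∨
      ∀ᵐ z ∂ν, ν (f ⁻¹' Metric.ball (f z) ε) = ⊤ := by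
  have := hQ.isProbabilityMeasure
  have zero_one := ErgodicSMul.aeconst_of_forall_preimage_smul_ae_eq
    (measurableSet_isolatedPairs hf ε) fun g =>
      hQ.preimage_smul_isolatedPairs_ae_eq hf (hfG g) ε
  refine (eventuallyConst_set.mp zero_one).imp (fun h => ?_) fun h => ?_
  · filter_upwards [Measure.ae_ae_of_ae_prod h] with z hz
    exact (hQ.ae_count_eq_zero_iff (measurableSet_preimage_ball hf _ _)).mp hz
  · filter_upwards [Measure.ae_ae_of_ae_prod h] with z hz
    exact (hQ.ae_count_ne_zero_iff (measurableSet_preimage_ball hf _ _)).mp hz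

theorem IsPoissonProcessLaw.ae_measure_preimage_ball_eq_top
    (hQ : IsPoissonProcessLaw ν Q) {f : Z → E} (hf : StronglyMeasurable f)
    (hfG : ∀ g : G, ∀ᵐ z ∂ν, ∀ᵐ z' ∂ν, dist (f (g • z)) (f (g • z')) = dist (f z) (f z')) :
    ∀ᵐ z ∂ν, ∀ ε > 0, ν (f ⁻¹' Metric.ball (f z) ε) = ⊤ := by
  have countably_many : ∀ᵐ z ∂ν, ∀ n : ℕ, ν (f ⁻¹' Metric.ball (f z) (1 / (n + 1))) = ⊤ := by
    refine ae_all_iff.mpr fun n => ?_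
    obtain h | h := hQ.ae_measure_preimage_ball_eq_zero_or_top hf hfG (1 / (n + 1))
    · filter_upwards [h, ae_measure_preimage_ball_ne_zero hf.isSeparable_range
        (Nat.one_div_pos_of_nat (n := n))] with z h0 h1 using absurd h0 h1
    · exact h
  filter_upwards [countably_many] with z hz ε hε
  obtain ⟨n, hn⟩ := exists_nat_one_div_lt hε
  exact measure_mono_top (preimage_mono (Metric.ball_subset_ball hn.le)) (hz n)

theorem IsPoissonProcessLaw.ae_eq_zero_of_lintegral_ne_top
    (hQ : IsPoissonProcessLaw ν Q) {f : Z → E} (hf : AEStronglyMeasurable f ν)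
    (hfG : ∀ g : G, ∀ᵐ z ∂ν, ∀ᵐ z' ∂ν, dist (f (g • z)) (f (g • z')) = dist (f z) (f z'))
    {φ : E → ℝ≥0∞} (hφ : Continuous φ) (hint : ∫⁻ z, φ (f z) ∂ν ≠ ⊤) :
    ∀ᵐ z ∂ν, φ (f z) = 0 := by
  have := hQ.isProbabilityMeasure
  have : SMulInvariantMeasure G Z ν := smulInvariantMeasure_of_prod (ν := Q)
  have modify : ∀ g : G, ∀ᵐ z ∂ν, f z = hf.mk f z ∧ f (g • z) = hf.mk f (g • z) := fun g =>
    hf.ae_eq_mk.and ((measurePreserving_smul g ν).quasiMeasurePreserving.ae hf.ae_eq_mk)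
  have hmkG : ∀ g : G, ∀ᵐ z ∂ν, ∀ᵐ z' ∂ν,
      dist (hf.mk f (g • z)) (hf.mk f (g • z')) = dist (hf.mk f z) (hf.mk f z') := by
    intro g
    filter_upwards [modify g, hfG g] with z hz hdist
    filter_upwards [modify g, hdist] with z' hz' hdist'
    rwa [← hz.1, ← hz.2, ← hz'.1, ← hz'.2]
  have hint_mk : ∫⁻ z, φ (hf.mk f z) ∂ν ≠ ⊤ :=
    lintegral_congr_ae (hf.ae_eq_mk.fun_comp φ) ▸ hint
  filter_upwards [hf.ae_eq_mk, hQ.ae_measure_preimage_ball_eq_top hf.stronglyMeasurable_mk hmkG]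
    with z hz htop
  rw [hz]
  exact eq_zero_of_measure_preimage_ball_eq_top hf.stronglyMeasurable_mk hφ hint_mk htop

end Ergodic

section Lp

variable {X : Type*} [MeasurableSpace X] {μ : Measure X}

theorem setLIntegral_enorm_le_add_edist (B : Set X) (u v : Lp ℝ 1 μ) :
    ∫⁻ y in B, ‖u y‖ₑ ∂μ ≤ ∫⁻ y in B, ‖v y‖ₑ ∂μ + edist u v := by
  calc
    _ ≤ ∫⁻ y in B, (‖v y‖ₑ + ‖u y - v y‖ₑ) ∂μ := lintegral_mono fun y => by
      simpa using enorm_add_le (v y) (u y - v y)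
    _ = ∫⁻ y in B, ‖v y‖ₑ ∂μ + ∫⁻ y in B, ‖u y - v y‖ₑ ∂μ :=
      lintegral_add_left' (Lp.aestronglyMeasurable v).restrict.enorm _
    _ ≤ ∫⁻ y in B, ‖v y‖ₑ ∂μ + ∫⁻ y, ‖u y - v y‖ₑ ∂μ := by
      gcongr
      exact Measure.restrict_le_self
    _ = ∫⁻ y in B, ‖v y‖ₑ ∂μ + edist u v := by
      rw [Lp.edist_def, eLpNorm_one_eq_lintegral_enorm]
      rfl

theorem continuous_setLIntegral_enorm (B : Set X) :
    Continuous fun u : Lp ℝ 1 μ => ∫⁻ y in B, ‖u y‖ₑ ∂μ :=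
  continuous_of_le_add_edist 1 ENNReal.one_ne_top fun u v => by
    simpa using setLIntegral_enorm_le_add_edist B u v

theorem dist_eq_of_comp_ae_eq {E : Type*} [NormedAddCommGroup E] {p : ℝ≥0∞} [Fact (1 ≤ p)]
    {T : X → X} (hT : MeasurePreserving T μ μ) {u v u' v' : Lp E p μ}
    (hu : (fun y => u (T y)) =ᵐ[μ] u') (hv : (fun y => v (T y)) =ᵐ[μ] v') :
    dist u v = dist u' v' := by
  have pullback : ∀ {w w' : Lp E p μ}, (fun y => w (T y)) =ᵐ[μ] w' →
      Lp.compMeasurePreserving T hT w = w' := fun hw =>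
    Lp.ext ((Lp.coeFn_compMeasurePreserving _ hT).trans hw)
  rw [← pullback hu, ← pullback hv, (Lp.isometry_compMeasurePreserving hT).dist_eq]

end Lp

section Allocation

variable {X : Type*} [MeasurableSpace X] {μ : Measure X} {P : Measure (CountableConfig X)}
  {Υ : X × CountableConfig X → Lp ℝ 1 μ}

theorem IsPoissonAllocation.isAEPoissonAllocation [MeasurableSpace.CountablySeparated X]
    (hΥ : IsPoissonAllocation μ P Υ) : IsAEPoissonAllocation μ P Υ where
  aemeasurable := (hΥ.measurable.comp_measurable
    (measurable_fst.prodMk measurable_addPoint)).aestronglyMeasurable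
  nonneg := Eventually.of_forall fun ω x _ => hΥ.nonneg x ω
  partition_of_unity := hΥ.partition_of_unity

theorem IsAEPoissonAllocation.ae_tsum_setLIntegral_enorm (hΥ : IsAEPoissonAllocation μ P Υ)
    (B : Set X) :
    ∀ᵐ ω ∂P, ∑' x : ω.carrier, ∫⁻ y in B, ‖Υ (x.1, ω) y‖ₑ ∂μ = μ B := by
  filter_upwards [hΥ.nonneg, hΥ.partition_of_unity] with ω hnonneg hsum
  have := ω.countable.to_subtype
  have nonneg_ae : ∀ᵐ y ∂μ, ∀ x : ω.carrier, 0 ≤ Υ (x.1, ω) y := ae_all_iff.mpr fun x =>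
    (Lp.coeFn_nonneg _).mpr (hnonneg x x.2)
  rw [← lintegral_tsum fun x => (Lp.aestronglyMeasurable _).restrict.enorm, ← setLIntegral_one]
  refine lintegral_congr_ae (ae_restrict_of_ae ?_)
  filter_upwards [nonneg_ae, hsum] with y hy hy1
  simp_rw [fun x : ω.carrier => Real.enorm_of_nonneg (hy x)]
  rw [← ENNReal.ofReal_tsum_of_nonneg hy hy1.summable, hy1.tsum_eq, ENNReal.ofReal_one]

variable [MeasurableSpace.CountablySeparated X] [SigmaFinite μ]

theorem IsAEPoissonAllocation.lintegral_setLIntegral_enorm (hΥ : IsAEPoissonAllocation μ P Υ)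
    (hP : IsPoissonProcessLaw μ P) (B : Set X) :
    ∫⁻ z, ∫⁻ y in B, ‖Υ (z.1, addPoint z.1 z.2) y‖ₑ ∂μ ∂μ.prod P = μ B := by
  have := hP.isProbabilityMeasure
  have mass : ∀ᵐ ω ∂P, ∑' x : ω.carrier,
      ∫⁻ y in B, ‖Υ (x.1, addPoint x.1 (erasePoint x.1 ω)) y‖ₑ ∂μ = μ B := by
    filter_upwards [hΥ.ae_tsum_setLIntegral_enorm B] with ω hω
    rw [← hω]
    exact tsum_congr fun x => by rw [addPoint_erasePoint x.2]
  calc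
    _ = ∫⁻ ω, ∑' x : ω.carrier,
        ∫⁻ y in B, ‖Υ (x.1, addPoint x.1 (erasePoint x.1 ω)) y‖ₑ ∂μ ∂P :=
      (hP.lintegral_tsum_erasePoint ((continuous_setLIntegral_enorm B).comp_aestronglyMeasurable
        hΥ.aemeasurable).aemeasurable).symm
    _ = μ B := by
      rw [lintegral_congr_ae mass, lintegral_const, measure_univ, mul_one]

variable {G : Type*} [Group G] [MulAction G X]

theorem IsEquivariantAllocation.ae_dist_smul_eq [MeasurableConstSMul G X]
    [SMulInvariantMeasure G X μ] (hΥ : IsEquivariantAllocation G μ P Υ)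
    (hP : IsPoissonProcessLaw μ P) (g : G) :
    ∀ᵐ z ∂μ.prod P, ∀ᵐ z' ∂μ.prod P,
      dist (Υ (g • z.1, addPoint (g • z.1) (g • z.2)))
          (Υ (g • z'.1, addPoint (g • z'.1) (g • z'.2))) =
        dist (Υ (z.1, addPoint z.1 z.2)) (Υ (z'.1, addPoint z'.1 z'.2)) := by
  have equivariant : ∀ᵐ z ∂μ.prod P,
      (fun y => Υ (g • z.1, addPoint (g • z.1) (g • z.2)) (g • y)) =ᵐ[μ]
        Υ (z.1, addPoint z.1 z.2) := by
    filter_upwards [hP.quasiMeasurePreserving_addPoint.ae (hΥ g)] with z hz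
    rw [← smul_addPoint]
    exact hz z.1 (mem_insert _ _)
  filter_upwards [equivariant] with z hz
  filter_upwards [equivariant] with z' hz'
  exact dist_eq_of_comp_ae_eq (measurePreserving_smul g μ) hz hz'

theorem IsAEPoissonAllocation.not_isEquivariantAllocation [MeasurableConstSMul G X] (hμ : μ ≠ 0)
    (hP : IsPoissonProcessLaw μ P) {Q : Measure (CountableConfig (X × CountableConfig X))}
    (hQ : IsPoissonProcessLaw (μ.prod P) Q)
    [ErgodicSMul G ((X × CountableConfig X) × CountableConfig (X × CountableConfig X))
      ((μ.prod P).prod Q)] (hΥ : IsAEPoissonAllocation μ P Υ) :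
    ¬ IsEquivariantAllocation G μ P Υ := by
  intro hG
  have := hP.isProbabilityMeasure
  have := hQ.isProbabilityMeasure
  have : SMulInvariantMeasure G (X × CountableConfig X) (μ.prod P) :=
    smulInvariantMeasure_of_prod (ν := Q)
  have : SMulInvariantMeasure G X μ := smulInvariantMeasure_of_prod (ν := P)
  have null : ∀ n, μ (spanningSets μ n) = 0 := by
    intro n
    have total := hΥ.lintegral_setLIntegral_enorm hP (spanningSets μ n)
    rw [← total, lintegral_congr_ae (hQ.ae_eq_zero_of_lintegral_ne_top hΥ.aemeasurable
      (hG.ae_dist_smul_eq hP) (continuous_setLIntegral_enorm (spanningSets μ n))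
      (total.trans_ne (measure_spanningSets_lt_top μ n).ne)), lintegral_zero]
  exact hμ (Measure.measure_univ_eq_zero.mp (iUnion_spanningSets μ ▸ measure_iUnion_null null))

end Allocation

theorem mainTheorem7_general {G X : Type*} [Group G] [MulAction G X] [MeasurableSpace X]
    [MeasurableSpace.CountablySeparated X] [MeasurableConstSMul G X] (μ : Measure X)
    [SigmaFinite μ] (hμ : μ ≠ 0) (P : Measure (CountableConfig X)) (hP : IsPoissonProcessLaw μ P)
    (Q : Measure (CountableConfig (X × CountableConfig X)))
    (hQ : IsPoissonProcessLaw (μ.prod P) Q)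
    (hErg : ErgodicSMul G
      ((X × CountableConfig X) × CountableConfig (X × CountableConfig X)) ((μ.prod P).prod Q)) :
    (¬ ∃ Υ : X × CountableConfig X → Lp ℝ 1 μ,
        IsPoissonAllocation μ P Υ ∧ IsEquivariantAllocation G μ P Υ) ∧
      (¬ ∃ Υ : X × CountableConfig X → Lp ℝ 1 μ,
        IsAEPoissonAllocation μ P Υ ∧ IsEquivariantAllocation G μ P Υ) := by
  refine ⟨?_, ?_⟩
  · rintro ⟨Υ, hΥ, hG⟩
    exact hΥ.isAEPoissonAllocation.not_isEquivariantAllocation hμ hP hQ hG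
  · rintro ⟨Υ, hΥ, hG⟩
    exact hΥ.not_isEquivariantAllocation hμ hP hQ hG

theorem mainTheorem7 {G X : Type*} [Group G] [MulAction G X]
    [MeasurableSpace X] [StandardBorelSpace X] [MeasurableConstSMul G X]
    (μ : Measure X) [SigmaFinite μ] [NullSingletonClass μ] [SMulInvariantMeasure G X μ] (hμ : μ ≠ 0)
    (P : Measure (CountableConfig X)) (hP : IsPoissonProcessLaw μ P)
    (Q : Measure (CountableConfig (X × CountableConfig X)))
    (hQ : IsPoissonProcessLaw (μ.prod P) Q)
    (hErg : ErgodicSMul G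
      ((X × CountableConfig X) × CountableConfig (X × CountableConfig X)) ((μ.prod P).prod Q)) :
    (¬ ∃ Υ : X × CountableConfig X → Lp ℝ 1 μ,
        IsPoissonAllocation μ P Υ ∧ IsEquivariantAllocation G μ P Υ) ∧
      (¬ ∃ Υ : X × CountableConfig X → Lp ℝ 1 μ,
        IsAEPoissonAllocation μ P Υ ∧ IsEquivariantAllocation G μ P Υ) :=
  mainTheorem7_general μ hμ P hP Q hQ hErg
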